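/- Conventions. A system $S$ in a category $\mathcal C$ is a set $S_0$ of objects of $\mathcal C$ together with a set $S_1$ of morphisms of $\mathcal C$ between these objects; it is finite if $S_0$ and $S_1$ are finite. It is path-connected if for every arrow $f\colon V\to W$ in $S_1$ there are paths of arrows of $S_1$ from $V$ to $W$ and from $W$ to $V$ (two vertices need not be joined by a path if there is no arrow between them). We write $\langle S\rangle$ for the smallest subcategory of $\mathcal C$ with object set $S_0$ that contains all arrows in $S_1$; its order $|\langle S\rangle|$ is the number of all its morphisms, and it is called finite if this order is finite. Proposition. Let $k$ be an integral domain of characteristic zero that is finitely presented as a ring (i.e. over $\mathbb Z$), and let $S_0$ be a finite set of integral schemes that are separated and of finite type over $k$ and flat over $\mathbb Z$. Then there is a constant $C(S_0)$, depending only on $S_0$, such that for every finite path-connected system $S$ in the category of $k$-schemes with vertex set $S_0$, all of whose arrows are dominant morphisms of $k$-schemes, the following holds: if $\langle S\rangle$ is finite, then $|\langle S\rangle|\le C(S_0)$. -/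

import Mathlib

universe v u

open CategoryTheory AlgebraicGeometry

namespace VarietySystems

/-- A system in a category `C`: a subquiver of the quiver underlying `C`, that is, a set of
objects together with a set of morphisms of `C` between these objects. -/
@[ext]
structure QuiverSystem (C : Type u) [Category.{v} C] where
  /-- the vertices -/
  obj : Set C
  /-- the arrows -/
  arr : MorphismProperty C
  source_mem : ∀ {X Y : C} {f : X ⟶ Y}, arr f → X ∈ obj
  target_mem : ∀ {X Y : C} {f : X ⟶ Y}, arr f → Y ∈ obj

/-- A subcategory of `C`: a subquiver that contains the identities of its objects and is closed
under composition. -/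
structure SubCat (C : Type u) [Category.{v} C] extends QuiverSystem C where
  id_mem : ∀ X ∈ obj, arr (𝟙 X)
  comp_mem : ∀ {X Y Z : C} (f : X ⟶ Y) (g : Y ⟶ Z), arr f → arr g → arr (f ≫ g)

/-- The order of a subcategory: the number of all its morphisms. -/
noncomputable def SubCat.order {C : Type u} [Category.{v} C] (D : SubCat C) : ℕ∞ :=
  D.arr.toSet.encard

/-- A subcategory is finite if it has finite order. -/
def SubCat.IsFinite {C : Type u} [Category.{v} C] (D : SubCat C) : Prop :=
  D.order ≠ ⊤

namespace QuiverSystem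

variable {C : Type u} [Category.{v} C]

/-- A system is finite if it has finitely many vertices and finitely many arrows. -/
def IsFinite (S : QuiverSystem C) : Prop :=
  S.obj.Finite ∧ S.arr.toSet.Finite

/-- There is a path `f₁, …, f_n` (with `n ≥ 1`) of arrows of `S` from `X` to `Y`. -/
def HasPath (S : QuiverSystem C) (X Y : C) : Prop :=
  Relation.TransGen (fun A B : C => ∃ f : A ⟶ B, S.arr f) X Y

/-- Two vertices are path-equivalent if there are paths between them in both directions. -/
def PathEquivalent (S : QuiverSystem C) (X Y : C) : Prop :=
  S.HasPath X Y ∧ S.HasPath Y X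

/-- The system obtained from `S` by deleting the arrows between vertices that are not
path-equivalent. -/
def circ (S : QuiverSystem C) : QuiverSystem C where
  obj := S.obj
  arr := fun X Y f => S.arr f ∧ S.PathEquivalent X Y
  source_mem h := S.source_mem h.1
  target_mem h := S.target_mem h.1

/-- `S` is path-connected if no arrow is deleted in passing to `S.circ`. -/
def IsPathConnected (S : QuiverSystem C) : Prop :=
  S = S.circ

/-- The morphisms of the subcategory generated by `S`. -/
inductive GeneratedArr (S : QuiverSystem C) : ∀ {X Y : C}, (X ⟶ Y) → Prop
  | of {X Y : C} (f : X ⟶ Y) (hf : S.arr f) : GeneratedArr S f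
  | id (X : C) (hX : X ∈ S.obj) : GeneratedArr S (𝟙 X)
  | comp {X Y Z : C} (f : X ⟶ Y) (g : Y ⟶ Z) (hf : GeneratedArr S f) (hg : GeneratedArr S g) :
      GeneratedArr S (f ≫ g)

theorem GeneratedArr.mem {S : QuiverSystem C} {X Y : C} {f : X ⟶ Y} (h : S.GeneratedArr f) :
    X ∈ S.obj ∧ Y ∈ S.obj := by
  induction h with
  | of f hf => exact ⟨S.source_mem hf, S.target_mem hf⟩
  | id X hX => exact ⟨hX, hX⟩
  | comp f g _ _ ihf ihg => exact ⟨ihf.1, ihg.2⟩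

/-- The subcategory `⟨S⟩` of `C` generated by `S`, with the same objects as `S`. -/
def generated (S : QuiverSystem C) : SubCat C where
  obj := S.obj
  arr := fun _ _ f => S.GeneratedArr f
  source_mem h := h.mem.1
  target_mem h := h.mem.2
  id_mem X hX := GeneratedArr.id X hX
  comp_mem f g hf hg := GeneratedArr.comp f g hf hg

/-- `⟨S⟩` is the smallest subcategory with the objects of `S` that contains the arrows of `S`. -/
theorem generated_isLeast (S : QuiverSystem C) :
    S.arr ≤ S.generated.arr ∧
      ∀ D : SubCat C, D.obj = S.obj → S.arr ≤ D.arr → S.generated.arr ≤ D.arr := by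
  refine ⟨fun _ _ f hf => GeneratedArr.of f hf, fun D hD hS X Y f hf => ?_⟩
  change S.GeneratedArr f at hf
  induction hf with
  | of f hf => exact hS _ hf
  | id X hX => exact D.id_mem X (hD ▸ hX)
  | comp f g _ _ ihf ihg => exact D.comp_mem f g ihf ihg

end QuiverSystem

/-- The scheme `X` over `Spec k` is an integral scheme, separated and of finite type over `k`,
and flat over `ℤ` (the unique morphism from `X` to the terminal scheme `Spec ℤ` is flat). -/
structure IsFlatModel {k : Type u} [CommRing k] (X : Over (Spec (CommRingCat.of k))) : Prop where
  isIntegral : IsIntegral X.left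
  isSeparated : IsSeparated X.hom
  locallyOfFiniteType : LocallyOfFiniteType X.hom
  quasiCompact : QuasiCompact X.hom
  flat_int : Flat (specULiftZIsTerminal.from X.left)

end VarietySystems

/-!
Write `𝒞 = ⟨S⟩`, and suppose that it is finite.

Dominant morphisms into reduced schemes can be cancelled on the left against morphisms into separated
schemes. So in the finite monoid of endomorphisms in `𝒞` of a vertex, a relation `σ ^ a = σ ^ b`
with `a < b` forces `σ ^ (b - a) = 1`. Path-connectedness gives every arrow of `𝒞` a companion in
the opposite direction, hence `𝒞` is a groupoid whose vertex groups are torsion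
(`QuiverSystem.GeneratedArr.exists_inverse`, `QuiverSystem.GeneratedArr.exists_pow_eq_one`).

It remains to bound the number of arrows `X ⟶ Y` by a quantity that does not depend on `S`, and
this is done with one point of each `X`. A vertex `X` has a point `x` with finite residue field,
since `X` is locally of finite type over `ℤ`. The local ring `O` of `X` at `x` is a Noetherian
domain, of characteristic zero by flatness. As in Minkowski's lemma, for `N` large a ring
endomorphism of `O` of finite order that is trivial modulo `𝔪 ^ (N + 1)` is the identity
(`exists_eq_one_of_pow_eq_one`); one `N` serves all orders, because by Artin–Rees division by the
residue characteristic loses only a bounded power of `𝔪`. So with `R = O ⧸ 𝔪 ^ (N + 1)`, a finite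
local ring, an automorphism of `X` of finite order that fixes the canonical point
`j : Spec R ⟶ X` is the identity (`exists_finite_local_point`). Consequently `f ↦ j ≫ f` is
injective on the arrows `X ⟶ Y` of `𝒞`, and its target, the set of `R`-valued points of `Y`, is
finite (`finite_hom_of_isLocalRing`) and independent of `S`.
-/

namespace VarietySystems

open IsLocalRing

/-! ### Endomorphisms of finite order of Noetherian local domains -/

/-- Dividing by a prime number costs at most a bounded power of the maximal ideal, uniformly in the
prime: primes outside the maximal ideal are units, and at most one prime lies in it, for which the
Artin–Rees lemma applies. -/
theorem exists_mem_pow_of_prime_mul_mem {O : Type*} [CommRing O] [IsDomain O] [IsLocalRing O]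
    [IsNoetherianRing O] [CharZero O] :
    ∃ N, ∀ ℓ : ℕ, ℓ.Prime → ∀ t, N ≤ t → ∀ y : O,
      (ℓ : O) * y ∈ maximalIdeal O ^ (2 * t + 1) → y ∈ maximalIdeal O ^ (t + 2) := by
  have unit_case (ℓ : ℕ) (hu : IsUnit (ℓ : O)) (t : ℕ) (ht : 1 ≤ t) (y : O)
      (hy : (ℓ : O) * y ∈ maximalIdeal O ^ (2 * t + 1)) : y ∈ maximalIdeal O ^ (t + 2) :=
    Ideal.pow_le_pow_right (by lia) ((Ideal.unit_mul_mem_iff_mem _ hu).1 hy)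
  by_cases hp : ∃ p : ℕ, p.Prime ∧ (p : O) ∈ maximalIdeal O
  · obtain ⟨p, hp, hpm⟩ := hp
    obtain ⟨c, hc⟩ := (maximalIdeal O).exists_pow_inf_eq_pow_smul (Ideal.span {(p : O)})
    refine ⟨c + 1, fun ℓ hℓ t ht y hy ↦ ?_⟩
    by_cases hu : IsUnit (ℓ : O)
    · exact unit_case ℓ hu t (by lia) y hy
    -- a proper ideal contains at most one rational prime
    obtain rfl : ℓ = p := by
      by_contra hne
      have hcop : IsCoprime (ℓ : O) (p : O) :=
        ((Nat.coprime_primes hℓ hp).2 hne).cast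
      obtain ⟨a, b, hab⟩ := hcop
      refine (Ideal.ne_top_iff_one _).1 (maximalIdeal.isMaximal O).ne_top ?_
      rw [← hab]
      exact add_mem (Ideal.mul_mem_left _ _ ((mem_maximalIdeal _).2 hu))
        (Ideal.mul_mem_left _ _ hpm)
    have h := (hc (2 * t + 1) (by lia)).le
      ⟨by simpa using hy, Ideal.mem_span_singleton.2 (dvd_mul_right _ y)⟩
    have h' : (ℓ : O) * y ∈ maximalIdeal O ^ (2 * t + 1 - c) * Ideal.span {(ℓ : O)} :=
      Submodule.smul_mono le_rfl inf_le_right h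
    obtain ⟨z, hz, hzy⟩ := Ideal.mem_mul_span_singleton.1 h'
    rw [mul_comm] at hzy
    obtain rfl := mul_left_cancel₀ (Nat.cast_ne_zero.2 hℓ.ne_zero) hzy
    exact Ideal.pow_le_pow_right (by lia) hz
  · push Not at hp
    exact ⟨1, fun ℓ hℓ t ht y hy ↦ unit_case ℓ (by simpa using hp ℓ hℓ) t ht y hy⟩

section
variable {R : Type*} [CommRing R] {I : Ideal R}

/-- An endomorphism that is trivial modulo `I ^ (t + 1)` moves elements of `I ^ (a + 1)` only by
elements of `I ^ (a + 1 + t)`, by the twisted Leibniz rule for `φ - 1`. -/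
theorem map_sub_mem_pow {t : ℕ} {φ : R →+* R}
    (hφ : ∀ x, φ x - x ∈ I ^ (t + 1)) (a : ℕ) {y : R} (hy : y ∈ I ^ (a + 1)) :
    φ y - y ∈ I ^ (a + 1 + t) := by
  induction a generalizing y with
  | zero => simpa [add_comm] using hφ y
  | succ a ih =>
    rw [pow_succ'] at hy
    induction hy using Submodule.mul_induction_on' with
    | mem_mul_mem x hx y hy =>
      have h1 : φ x ∈ I := by
        simpa using add_mem (Ideal.pow_le_self (Nat.succ_ne_zero t) (hφ x)) hx
      have h2 : φ (x * y) - x * y = φ x * (φ y - y) + (φ x - x) * y := by rw [map_mul]; ring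
      rw [h2]
      refine add_mem ?_ ?_
      · have := Ideal.mul_mem_mul h1 (ih hy)
        rw [← pow_succ'] at this
        exact Ideal.pow_le_pow_right (by lia) this
      · have := Ideal.mul_mem_mul (hφ x) hy
        rw [← pow_add] at this
        exact Ideal.pow_le_pow_right (by lia) this
    | add x _ y _ hx hy =>
      have : φ (x + y) - (x + y) = (φ x - x) + (φ y - y) := by rw [map_add]; ring
      exact this ▸ add_mem hx hy

theorem pow_apply_sub_mem {J : Ideal R} {φ : R →+* R} (hφ : ∀ x, φ x - x ∈ J) (j : ℕ) (x : R) :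
    (φ ^ j) x - x ∈ J := by
  induction j generalizing x with
  | zero => simp
  | succ j ih => simpa [pow_succ, RingHom.mul_def] using add_mem (ih (φ x)) (hφ x)

/-- If `φ ^ n = 1`, the sum of the `φ ^ j (φ x - x)` over `j < n` telescopes to zero; since `φ ^ j`
barely moves `φ x - x`, the sum is close to `n * (φ x - x)`. -/
theorem natCast_mul_sub_mem_pow {t n : ℕ} {φ : R →+* R}
    (hφ : ∀ x, φ x - x ∈ I ^ (t + 1)) (hn : φ ^ n = 1) (x : R) :
    (n : R) * (φ x - x) ∈ I ^ (2 * t + 1) := by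
  have h0 : ∑ j ∈ Finset.range n, (φ ^ j) (φ x - x) = 0 := by
    have := Finset.sum_range_sub (fun j ↦ (φ ^ j) x) n
    simpa [pow_succ, RingHom.mul_def, hn] using this
  have h1 : (n : R) * (φ x - x) =
      -∑ j ∈ Finset.range n, ((φ ^ j) (φ x - x) - (φ x - x)) := by
    rw [Finset.sum_sub_distrib, h0, Finset.sum_const, Finset.card_range, nsmul_eq_mul, zero_sub,
      neg_neg]
  rw [h1]
  refine neg_mem (sum_mem fun j _ ↦ ?_)
  have := map_sub_mem_pow (pow_apply_sub_mem hφ j) t (hφ x)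
  exact Ideal.pow_le_pow_right (by lia) this
end

/-- A version of Minkowski's lemma: some congruence subgroup, with respect to the maximal ideal, of
the automorphism group of a Noetherian local domain of characteristic zero is torsion-free. -/
theorem exists_eq_one_of_pow_eq_one {O : Type*} [CommRing O] [IsDomain O] [IsLocalRing O]
    [IsNoetherianRing O] [CharZero O] :
    ∃ N : ℕ, ∀ φ : O →+* O, (∀ x, φ x - x ∈ maximalIdeal O ^ (N + 1)) →
      ∀ n, n ≠ 0 → φ ^ n = 1 → φ = 1 := by
  obtain ⟨N, hN⟩ := exists_mem_pow_of_prime_mul_mem (O := O)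
  refine ⟨N, fun φ hφ n ↦ ?_⟩
  induction n using Nat.recOnMul generalizing φ with
  | zero => exact fun h ↦ absurd rfl h
  | one => simp
  | prime ℓ hℓ =>
    intro _ hpow
    -- triviality modulo a power of the maximal ideal improves to the next power indefinitely
    have key (i : ℕ) : ∀ x, φ x - x ∈ maximalIdeal O ^ (N + i + 1) := by
      induction i with
      | zero => exact hφ
      | succ i ih => exact fun x ↦ hN ℓ hℓ _ (by lia) _ (natCast_mul_sub_mem_pow ih hpow x)
    ext x
    have hmem : φ x - x ∈ ⨅ i, maximalIdeal O ^ i :=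
      (Submodule.mem_iInf _).2 fun i ↦ Ideal.pow_le_pow_right (by lia) (key i x)
    rw [Ideal.iInf_pow_eq_bot_of_isLocalRing _ (maximalIdeal.isMaximal O).ne_top] at hmem
    exact sub_eq_zero.1 hmem
  | mul a b iha ihb =>
    intro hab hpow
    rw [pow_mul] at hpow
    refine iha φ hφ (left_ne_zero_of_mul hab) ?_
    exact ihb (φ ^ a) (pow_apply_sub_mem hφ a) (right_ne_zero_of_mul hab) hpow

/-! ### Rings of finite type over the integers -/

instance isJacobsonRing_int : IsJacobsonRing ℤ := by
  rw [isJacobsonRing_iff_sInf_maximal]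
  intro P hP
  by_cases h : P = ⊥
  · refine ⟨{J | J.IsMaximal}, fun J hJ ↦ Or.inl hJ, ?_⟩
    rw [h, eq_comm, eq_bot_iff]
    intro n hn
    by_contra hn0
    obtain ⟨p, hp, hprime⟩ := Nat.exists_infinite_primes (n.natAbs + 1)
    have hmax : (Ideal.span {(p : ℤ)}).IsMaximal :=
      PrincipalIdealRing.isMaximal_of_irreducible (Nat.prime_iff_prime_int.1 hprime).irreducible
    have hdvd := Ideal.mem_span_singleton.1 ((Submodule.mem_sInf.1 hn) _ hmax)
    have := Nat.le_of_dvd (Int.natAbs_pos.2 hn0) (Int.natCast_dvd.1 hdvd)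
    lia
  · exact ⟨{P}, by simpa using Or.inl (hP.isMaximal h), by simp⟩

/-- The arithmetic Nullstellensatz. -/
theorem finite_of_field_of_finiteType_int (K : Type*) [Field K]
    (hK : (Int.castRingHom K).FiniteType) : Finite K := by
  have hfin : (algebraMap ℤ K).Finite := RingHom.finite_iff_finiteType_of_isJacobsonRing.2 hK
  have : Module.Finite ℤ K := RingHom.finite_algebraMap.1 hfin
  have hinj : ¬ Function.Injective (algebraMap ℤ K) := fun h ↦
    Int.not_isField (isField_of_isIntegral_of_isField h (Field.toIsField K))
  rw [injective_iff_map_eq_zero] at hinj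
  push Not at hinj
  obtain ⟨n, hn, hn0⟩ := hinj
  refine Module.finite_of_fg_torsion K fun x ↦ ⟨⟨n, mem_nonZeroDivisors_of_ne_zero hn0⟩, ?_⟩
  rw [Submonoid.smul_def, Algebra.smul_def, hn, zero_mul]

theorem finite_quotient_of_isMaximal {A : Type*} [CommRing A] [Algebra.FiniteType ℤ A]
    (M : Ideal A) [M.IsMaximal] : Finite (A ⧸ M) := by
  let := Ideal.Quotient.field M
  refine finite_of_field_of_finiteType_int (A ⧸ M) ?_
  have h : (algebraMap ℤ A).FiniteType := RingHom.finiteType_algebraMap.2 inferInstance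
  rw [RingHom.ext_int (Int.castRingHom (A ⧸ M)) ((Ideal.Quotient.mk M).comp (algebraMap ℤ A))]
  exact (RingHom.FiniteType.of_surjective _ Ideal.Quotient.mk_surjective).comp h

theorem finite_ringHom_of_finiteType (A B : Type*) [CommRing A] [CommRing B] [Finite B]
    [Algebra.FiniteType ℤ A] : Finite (A →+* B) := by
  obtain ⟨s, hs⟩ := Algebra.FiniteType.out (R := ℤ) (A := A)
  refine Finite.of_injective (fun (φ : A →+* B) (x : s) ↦ φ x) fun φ ψ h ↦ ?_
  have : φ.toIntAlgHom = ψ.toIntAlgHom :=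
    AlgHom.ext_of_adjoin_eq_top hs fun x hx ↦ congrFun h ⟨x, hx⟩
  exact RingHom.ext fun x ↦ DFunLike.congr_fun this x

/-! ### Schemes of finite type over the integers -/

theorem finiteType_int_section {k : Type u} [CommRing k] [Algebra.FiniteType ℤ k] {X : Scheme.{u}}
    (f : X ⟶ Spec (CommRingCat.of k)) [LocallyOfFiniteType f] {U : X.Opens}
    (hU : IsAffineOpen U) : Algebra.FiniteType ℤ Γ(X, U) := by
  have h1 : (f.appLE ⊤ U le_top).hom.FiniteType :=
    f.finiteType_appLE (isAffineOpen_top _) hU le_top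
  have h2 : (Scheme.ΓSpecIso (CommRingCat.of k)).inv.hom.FiniteType :=
    RingHom.FiniteType.of_surjective _
      (ConcreteCategory.bijective_of_isIso (Scheme.ΓSpecIso (CommRingCat.of k)).inv).2
  have h3 : (algebraMap ℤ k).FiniteType := RingHom.finiteType_algebraMap.2 inferInstance
  have h4 := (h1.comp h2).comp h3
  rw [← RingHom.finiteType_algebraMap]
  convert! h4
  exact RingHom.ext_int _ _

/-- Stated with `ULift ℤ`, the spectrum of which is the terminal scheme in universe `u`. -/
theorem charZero_section {X : Scheme.{u}} (f : X ⟶ Spec (CommRingCat.of (ULift.{u} ℤ)))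
    [Flat f] {U : X.Opens} (hU : IsAffineOpen U) [Nontrivial Γ(X, U)] : CharZero Γ(X, U) := by
  have h1 : (f.appLE ⊤ U le_top).hom.Flat :=
    f.flat_appLE (isAffineOpen_top _) hU le_top
  have h2 : (Scheme.ΓSpecIso (CommRingCat.of (ULift.{u} ℤ))).inv.hom.Flat :=
    RingHom.Flat.of_bijective
      (ConcreteCategory.bijective_of_isIso (Scheme.ΓSpecIso (CommRingCat.of (ULift.{u} ℤ))).inv)
  have h3 : (ULift.ringEquiv.{0, u} (R := ℤ)).symm.toRingHom.Flat :=
    RingHom.Flat.of_bijective (ULift.ringEquiv.{0, u} (R := ℤ)).symm.bijective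
  have h4 := h3.comp (h2.comp h1)
  have : Module.Flat ℤ Γ(X, U) := by
    rw [← RingHom.flat_algebraMap_iff]
    convert! h4
    exact RingHom.ext_int _ _
  refine charZero_of_inj_zero fun n hn ↦ by_contra fun hn0 ↦ ?_
  have hreg : IsSMulRegular Γ(X, U) (n : ℤ) :=
    Module.Flat.isSMulRegular_of_nonZeroDivisors
      (mem_nonZeroDivisors_of_ne_zero (Nat.cast_ne_zero.2 hn0))
  refine one_ne_zero (hreg (?_ : (n : ℤ) • (1 : Γ(X, U)) = (n : ℤ) • 0))
  rw [Algebra.smul_def, map_natCast, hn, zero_mul, smul_zero]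

/-- The point is a closed point of a nonempty affine open subscheme. -/
theorem exists_point_finite_residueField {k : Type u} [CommRing k] [Algebra.FiniteType ℤ k]
    {X : Scheme.{u}} [IsIntegral X] (f : X ⟶ Spec (CommRingCat.of k)) [LocallyOfFiniteType f]
    (g : X ⟶ Spec (CommRingCat.of (ULift.{u} ℤ))) [Flat g] :
    ∃ x : X, IsNoetherianRing (X.presheaf.stalk x) ∧ CharZero (X.presheaf.stalk x) ∧
      Finite (X.presheaf.stalk x ⧸ maximalIdeal (X.presheaf.stalk x)) := by
  obtain ⟨y⟩ : Nonempty X := inferInstance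
  obtain ⟨_, ⟨U, hU, rfl⟩, hyU, -⟩ :=
    X.isBasis_affineOpens.exists_subset_of_mem_open (Set.mem_univ y) isOpen_univ
  have : Nonempty U := ⟨⟨y, hyU⟩⟩
  have : Algebra.FiniteType ℤ Γ(X, U) := finiteType_int_section f hU
  have : CharZero Γ(X, U) := charZero_section g hU
  have : IsNoetherianRing Γ(X, U) := Algebra.FiniteType.isNoetherianRing ℤ _
  obtain ⟨M, hM⟩ := Ideal.exists_maximal Γ(X, U)
  let z : PrimeSpectrum Γ(X, U) := ⟨M, hM.isPrime⟩
  have hz : hU.fromSpec z ∈ U := hU.range_fromSpec.le ⟨z, rfl⟩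
  have hloc := hU.isLocalization_stalk' z hz
  let x : X := hU.fromSpec z
  let : Algebra Γ(X, U) (X.presheaf.stalk x) :=
    TopCat.Presheaf.algebra_section_stalk X.presheaf (⟨x, hz⟩ : U)
  have hloc : IsLocalization.AtPrime (X.presheaf.stalk x) M := hloc
  refine ⟨x, IsLocalization.isNoetherianRing M.primeCompl _ inferInstance,
    charZero_of_injective_ringHom
      (IsLocalization.injective (X.presheaf.stalk x) M.primeCompl_le_nonZeroDivisors), ?_⟩
  have := finite_quotient_of_isMaximal M
  exact Finite.of_equiv _
    (IsLocalization.AtPrime.equivQuotMaximalIdeal M (X.presheaf.stalk x)).toEquiv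

/-! ### Points with values in finite local rings -/

theorem isDominant_fromSpecStalk {X : Scheme.{u}} [IrreducibleSpace X] (x : X) :
    IsDominant (X.fromSpecStalk x) := by
  refine ⟨?_⟩
  rw [DenseRange, Scheme.range_fromSpecStalk]
  have : genericPoint X ∈ {y : X | y ⤳ x} := genericPoint_specializes x
  refine Dense.mono (Set.singleton_subset_iff.2 this) ?_
  exact dense_iff_closure_eq.2 (genericPoint_closure X)

theorem specMap_pow_comp {X : Scheme.{u}} {R : Type u} [CommRing R] {φ : R →+* R}
    {i : Spec (CommRingCat.of R) ⟶ X} {σ : X ⟶ X}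
    (h : Spec.map (CommRingCat.ofHom φ) ≫ i = i ≫ σ) (n : ℕ) :
    Spec.map (CommRingCat.ofHom (φ ^ n)) ≫ i = i ≫ (End.of σ ^ n) := by
  induction n with
  | zero =>
    rw [pow_zero, pow_zero, End.one_def, Category.comp_id, RingHom.one_def]
    exact (congrArg (· ≫ i) (Spec.map_id _)).trans (Category.id_comp i)
  | succ n ih =>
    rw [pow_succ, pow_succ', End.mul_def, RingHom.mul_def, CommRingCat.ofHom_comp, Spec.map_comp,
      Category.assoc, h, reassoc_of% ih]

/-- There is a point with values in a finite local ring that detects whether an endomorphism of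
finite order is trivial: the spectrum of a quotient `O ⧸ 𝔪 ^ (N + 1)` of the local ring `O` at a
point with finite residue field. -/
theorem exists_finite_local_point {k : Type u} [CommRing k] [Algebra.FiniteType ℤ k]
    {X : Scheme.{u}} [IsIntegral X] (f : X ⟶ Spec (CommRingCat.of k)) [LocallyOfFiniteType f]
    [IsSeparated f] (g : X ⟶ Spec (CommRingCat.of (ULift.{u} ℤ))) [Flat g] :
    ∃ (R : Type u) (_ : CommRing R) (_ : Finite R) (_ : IsLocalRing R)
      (j : Spec (CommRingCat.of R) ⟶ X), ∀ σ : X ⟶ X, σ ≫ f = f → j ≫ σ = j →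
        ∀ n, n ≠ 0 → End.of σ ^ n = 1 → σ = 𝟙 X := by
  obtain ⟨x, _, _, _⟩ := exists_point_finite_residueField f g
  let O := X.presheaf.stalk x
  obtain ⟨N, hN⟩ := exists_eq_one_of_pow_eq_one (O := O)
  let I : Ideal O := maximalIdeal O ^ (N + 1)
  have hI : I ≤ maximalIdeal O := Ideal.pow_le_self (Nat.succ_ne_zero N)
  have : Nontrivial (O ⧸ I) := Ideal.Quotient.nontrivial_iff.2
    (ne_top_of_le_ne_top (maximalIdeal.isMaximal O).ne_top hI)
  have hmk : IsLocalHom (Ideal.Quotient.mk I) :=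
    IsLocalHom.of_surjective _ Ideal.Quotient.mk_surjective
  have : IsLocalRing (O ⧸ I) := IsLocalRing.of_surjective' _ Ideal.Quotient.mk_surjective
  refine ⟨O ⧸ I, inferInstance,
    Ideal.finite_quotient_pow (IsNoetherian.noetherian (maximalIdeal O)) _, inferInstance,
    Spec.map (CommRingCat.ofHom (Ideal.Quotient.mk I)) ≫ X.fromSpecStalk x,
    fun σ hσf hσ n hn hpow ↦ ?_⟩
  have hx : σ x = x := by
    let c : Spec (CommRingCat.of (O ⧸ I)) := closedPoint (O ⧸ I)
    have h1 : Spec.map (CommRingCat.ofHom (Ideal.Quotient.mk I)) c = closedPoint O :=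
      IsLocalRing.comap_closedPoint (Ideal.Quotient.mk I)
    have h2 : X.fromSpecStalk x (Spec.map (CommRingCat.ofHom (Ideal.Quotient.mk I)) c) = x :=
      (congrArg (X.fromSpecStalk x) h1).trans Scheme.fromSpecStalk_closedPoint
    have h3 := congrArg (fun q ↦ q c) hσ
    simp only [Scheme.Hom.comp_apply] at h3
    rwa [h2] at h3
  -- `σ` fixes `x`, so it induces an endomorphism `φ` of the local ring at `x`
  have hspec : σ x ⤳ x := specializes_of_eq hx
  let φ : O ⟶ O := X.presheaf.stalkSpecializes hspec ≫ σ.stalkMap x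
  have hφ : Spec.map (CommRingCat.ofHom φ.hom) ≫ X.fromSpecStalk x = X.fromSpecStalk x ≫ σ := by
    rw [CommRingCat.ofHom_hom, Spec.map_comp, Category.assoc,
      Scheme.SpecMap_stalkSpecializes_fromSpecStalk, Scheme.SpecMap_stalkMap_fromSpecStalk]
  have hmod (y : O) : φ.hom y - y ∈ I := by
    rw [Category.assoc, ← hφ, ← Category.assoc, cancel_mono, ← Spec.map_comp] at hσ
    have := congrArg (fun q ↦ q.hom y) (Spec.map_injective hσ)
    exact Ideal.Quotient.eq.1 this
  have hφn : φ.hom ^ n = 1 := by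
    have := specMap_pow_comp hφ n
    rw [hpow, End.one_def, Category.comp_id] at this
    have h1 : Spec.map (CommRingCat.ofHom (φ.hom ^ n)) = 𝟙 _ :=
      (cancel_mono (X.fromSpecStalk x)).1 (this.trans (Category.id_comp _).symm)
    exact congrArg (fun q ↦ q.hom) (Spec.map_injective (h1.trans (Spec.map_id _).symm))
  have hφ1 := hN φ.hom hmod n hn hφn
  have := isDominant_fromSpecStalk x
  refine ext_of_isDominant_of_isSeparated f (by simpa using hσf)
    (X.fromSpecStalk x) ?_
  have := specMap_pow_comp hφ 0
  rw [← hφ, hφ1]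
  simpa using this

/-- A morphism from the spectrum of a local ring factors through any open subscheme that contains
the image of the closed point, so finitely many affine open subschemes of `X` account for all
`R`-valued points, and each has only finitely many. -/
theorem finite_hom_of_isLocalRing {k : Type u} [CommRing k] [Algebra.FiniteType ℤ k]
    {X : Scheme.{u}} (f : X ⟶ Spec (CommRingCat.of k)) [LocallyOfFiniteType f] [QuasiCompact f]
    (R : Type u) [CommRing R] [Finite R] [IsLocalRing R] :
    Finite (Spec (CommRingCat.of R) ⟶ X) := by
  have haff (U : X.affineOpens) : Finite (Spec (CommRingCat.of R) ⟶ U.1.toScheme) := by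
    have : Algebra.FiniteType ℤ Γ(X, U.1) := finiteType_int_section f U.2
    have := finite_ringHom_of_finiteType Γ(X, U.1) R
    have : IsAffine U.1.toScheme := U.2
    refine Finite.of_injective (β := Γ(X, U.1) →+* R) (fun q ↦
      (U.1.topIso.inv ≫ q.appTop ≫ (Scheme.ΓSpecIso (CommRingCat.of R)).hom).hom) fun q q' h ↦ ?_
    have h' := CommRingCat.hom_ext h
    rw [cancel_epi, cancel_mono] at h'
    exact ext_of_isAffine h'
  have : CompactSpace X := QuasiCompact.compactSpace_of_compactSpace f
  obtain ⟨s, hs⟩ := isCompact_univ.elim_finite_subcover (fun U : X.affineOpens ↦ (U.1 : Set X))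
    (fun U ↦ U.1.2) (fun x _ ↦ by
      obtain ⟨_, ⟨U, hU, rfl⟩, hxU, -⟩ :=
        X.isBasis_affineOpens.exists_subset_of_mem_open (Set.mem_univ x) isOpen_univ
      exact Set.mem_iUnion.2 ⟨⟨U, hU⟩, hxU⟩)
  rw [← Set.finite_univ_iff]
  refine (s.finite_toSet.biUnion fun U _ ↦ Set.finite_range
    (fun q : Spec (CommRingCat.of R) ⟶ U.1.toScheme ↦ q ≫ U.1.ι)).subset fun q _ ↦ ?_
  obtain ⟨U, hUs, hU⟩ := Set.mem_iUnion₂.1 (hs (Set.mem_univ (q (closedPoint R))))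
  refine Set.mem_iUnion₂.2 ⟨U, hUs, IsOpenImmersion.lift U.1.ι q ?_, IsOpenImmersion.lift_fac _ _ _⟩
  have htop := Scheme.preimage_eq_top_of_closedPoint_mem (f := q) hU
  rintro _ ⟨y, rfl⟩
  have : y ∈ q ⁻¹ᵁ U.1 := htop ▸ trivial
  simpa using this

/-! ### Finite path-connected systems of arrows with left cancellation -/

namespace QuiverSystem

variable {C : Type u} [Category.{v} C] {S : QuiverSystem C}

theorem HasPath.exists_generatedArr {X Y : C} (h : S.HasPath X Y) :
    ∃ f : X ⟶ Y, S.GeneratedArr f := by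
  induction h with
  | single h => exact h.imp fun f hf ↦ .of f hf
  | tail _ h ih =>
    obtain ⟨f, hf⟩ := ih
    obtain ⟨g, hg⟩ := h
    exact ⟨f ≫ g, .comp f g hf (.of g hg)⟩

theorem IsPathConnected.exists_generatedArr_symm (hS : S.IsPathConnected) {X Y : C} {f : X ⟶ Y}
    (hf : S.GeneratedArr f) : ∃ g : Y ⟶ X, S.GeneratedArr g := by
  induction hf with
  | of f hf =>
    rw [hS] at hf
    exact HasPath.exists_generatedArr hf.2.2
  | id X hX => exact ⟨𝟙 X, .id X hX⟩
  | comp f g _ _ ihf ihg =>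
    obtain ⟨f', hf'⟩ := ihf
    obtain ⟨g', hg'⟩ := ihg
    exact ⟨g' ≫ f', .comp g' f' hg' hf'⟩

theorem GeneratedArr.pow {X : C} {σ : X ⟶ X} (hσ : S.GeneratedArr σ) (n : ℕ) :
    S.GeneratedArr (End.asHom (End.of σ ^ n)) := by
  induction n with
  | zero => exact .id X hσ.mem.1
  | succ n ih => rw [pow_succ']; exact .comp _ _ ih hσ

theorem finite_setOf_generatedArr (hfin : S.generated.IsFinite) (X Y : C) :
    {f : X ⟶ Y | S.GeneratedArr f}.Finite := by
  have h : S.generated.arr.toSet.Finite := Set.encard_ne_top_iff.1 hfin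
  refine Set.Finite.of_finite_image (f := fun f : X ⟶ Y ↦ Arrow.mk f) (h.subset ?_) ?_
  · rintro _ ⟨f, hf, rfl⟩
    exact hf
  · intro f _ g _ hfg
    exact (Arrow.mk_inj _ _).1 hfg

/-- An endomorphism `σ` in `⟨S⟩` satisfies `σ ^ a = σ ^ b` for some `a < b`, and `σ ^ a` can be
cancelled. -/
theorem GeneratedArr.exists_pow_eq_one (hfin : S.generated.IsFinite)
    (hepi : ∀ {X Y : C} {f : X ⟶ Y}, S.GeneratedArr f →
      ∀ {Z : C} (g h : Y ⟶ Z), Z ∈ S.obj → f ≫ g = f ≫ h → g = h)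
    {X : C} {σ : X ⟶ X} (hσ : S.GeneratedArr σ) : ∃ n, n ≠ 0 ∧ End.of σ ^ n = 1 := by
  have := (finite_setOf_generatedArr hfin X X).to_subtype
  obtain ⟨a, b, hab, h⟩ := Finite.exists_ne_map_eq_of_infinite
    (fun n : ℕ ↦ (⟨_, hσ.pow n⟩ : {f : X ⟶ X | S.GeneratedArr f}))
  wlog hlt : a < b generalizing a b
  · exact this b a hab.symm h.symm (by lia)
  obtain ⟨n, rfl⟩ := Nat.exists_eq_add_of_lt hlt
  refine ⟨n + 1, by simp, (hepi (hσ.pow a) (𝟙 X) (End.of σ ^ (n + 1)) hσ.mem.1 ?_).symm⟩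
  rw [Category.comp_id]
  have h1 : End.of σ ^ a = End.of σ ^ (a + n + 1) := congrArg Subtype.val h
  refine h1.trans ?_
  rw [add_assoc, add_comm, pow_add]
  rfl

/-- In `⟨S⟩` every arrow is invertible. -/
theorem GeneratedArr.exists_inverse (hS : S.IsPathConnected) (hfin : S.generated.IsFinite)
    (hepi : ∀ {X Y : C} {f : X ⟶ Y}, S.GeneratedArr f →
      ∀ {Z : C} (g h : Y ⟶ Z), Z ∈ S.obj → f ≫ g = f ≫ h → g = h)
    {X Y : C} {f : X ⟶ Y} (hf : S.GeneratedArr f) :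
    ∃ g : Y ⟶ X, S.GeneratedArr g ∧ f ≫ g = 𝟙 X ∧ g ≫ f = 𝟙 Y := by
  obtain ⟨g, hg⟩ := hS.exists_generatedArr_symm hf
  obtain ⟨n, hn, h⟩ := (GeneratedArr.comp f g hf hg).exists_pow_eq_one hfin hepi
  obtain ⟨n, rfl⟩ := Nat.exists_eq_succ_of_ne_zero hn
  have hpow := (GeneratedArr.comp f g hf hg).pow n
  have h1 : f ≫ g ≫ End.asHom (End.of (f ≫ g) ^ n) = 𝟙 X := by
    rw [pow_succ, End.mul_def] at h
    exact (Category.assoc _ _ _).symm.trans h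
  refine ⟨_, .comp _ _ hg hpow, h1, hepi hf _ _ hf.mem.2 ?_⟩
  rw [← Category.assoc, h1, Category.id_comp, Category.comp_id]

end QuiverSystem

/-! ### Systems of flat models -/

theorem IsFlatModel.eq_of_comp_eq {k : Type u} [CommRing k]
    {X Y Z : Over (Spec (CommRingCat.of k))} (hY : IsFlatModel Y) (hZ : IsFlatModel Z)
    {f : X ⟶ Y} (hf : IsDominant f.left) {g h : Y ⟶ Z} (hgh : f ≫ g = f ≫ h) : g = h := by
  have := hY.isIntegral
  have := hZ.isSeparated
  refine Over.OverMorphism.ext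
    (ext_of_isDominant_of_isSeparated Z.hom ((Over.w g).trans (Over.w h).symm) f.left ?_)
  simpa using congrArg CommaMorphism.left hgh

theorem IsFlatModel.exists_finite_local_point {k : Type u} [CommRing k] [Algebra.FiniteType ℤ k]
    {X : Over (Spec (CommRingCat.of k))} (hX : IsFlatModel X) :
    ∃ (R : Type u) (_ : CommRing R) (_ : Finite R) (_ : IsLocalRing R)
      (j : Spec (CommRingCat.of R) ⟶ X.left), ∀ σ : X ⟶ X, j ≫ σ.left = j →
        ∀ n, n ≠ 0 → End.of σ ^ n = 1 → σ = 𝟙 X := by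
  have := hX.isIntegral
  have := hX.isSeparated
  have := hX.locallyOfFiniteType
  have := hX.flat_int
  obtain ⟨R, _, _, _, j, hj⟩ :=
    VarietySystems.exists_finite_local_point X.hom (specULiftZIsTerminal.from X.left)
  refine ⟨R, inferInstance, inferInstance, inferInstance, j, fun σ hσ n hn hpow ↦ ?_⟩
  refine Over.OverMorphism.ext (hj σ.left (Over.w σ) hσ n hn ?_)
  have hmap (m : ℕ) : CommaMorphism.left (End.asHom (End.of σ ^ m)) = End.of σ.left ^ m := by
    induction m with
    | zero => rfl
    | succ m ih => rw [pow_succ, pow_succ, End.mul_def, End.mul_def, ← ih]; rfl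
  rw [← hmap, hpow]
  rfl

theorem QuiverSystem.GeneratedArr.isDominant {k : Type u} [CommRing k]
    {S : QuiverSystem (Over (Spec (CommRingCat.of k)))}
    (hS : ∀ (X Y : Over (Spec (CommRingCat.of k))) (f : X ⟶ Y), S.arr f → IsDominant f.left)
    {X Y : Over (Spec (CommRingCat.of k))} {f : X ⟶ Y} (hf : S.GeneratedArr f) :
    IsDominant f.left := by
  induction hf with
  | of f hf => exact hS _ _ f hf
  | id X hX => rw [Over.id_left]; infer_instance
  | comp f g _ _ ihf ihg => rw [Over.comp_left]; infer_instance

end VarietySystems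

theorem proposition3p2 {k : Type u} [CommRing k] [IsDomain k] [CharZero k]
    [Algebra.FinitePresentation ℤ k]
    (S₀ : Set (Over (Spec (CommRingCat.of k)))) (hfin : S₀.Finite)
    (hS₀ : ∀ X ∈ S₀, VarietySystems.IsFlatModel X) :
    ∃ B : ℕ, ∀ S : VarietySystems.QuiverSystem (Over (Spec (CommRingCat.of k))),
      S.obj = S₀ → S.IsFinite → S.IsPathConnected →
      (∀ (X Y : Over (Spec (CommRingCat.of k))) (f : X ⟶ Y), S.arr f → IsDominant f.left) →
      S.generated.IsFinite → S.generated.order ≤ (B : ℕ∞) := by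
  have : Algebra.FiniteType ℤ k := Algebra.FiniteType.of_finitePresentation
  have : Finite S₀ := hfin
  choose R _ _ _ j hj using fun X : S₀ ↦ (hS₀ X.1 X.2).exists_finite_local_point
  have hT (p : S₀ × S₀) : Finite (Spec (CommRingCat.of (R p.1)) ⟶ p.2.1.left) := by
    have := (hS₀ _ p.2.2).locallyOfFiniteType
    have := (hS₀ _ p.2.2).quasiCompact
    exact VarietySystems.finite_hom_of_isLocalRing p.2.1.hom (R p.1)
  -- pairs of vertices `X`, `Y` with an `R X`-valued point of `Y`
  let T := Σ p : S₀ × S₀, (Spec (CommRingCat.of (R p.1)) ⟶ p.2.1.left)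
  refine ⟨Nat.card T, fun S hobj _ hconn hdom hgen ↦ ?_⟩
  have hepi {X Y : Over (Spec (CommRingCat.of k))} {f : X ⟶ Y} (hf : S.GeneratedArr f)
      {Z : Over (Spec (CommRingCat.of k))} (g h : Y ⟶ Z) (hZ : Z ∈ S.obj)
      (hgh : f ≫ g = f ≫ h) : g = h :=
    (hS₀ _ (hobj ▸ hf.mem.2)).eq_of_comp_eq (hS₀ _ (hobj ▸ hZ)) (hf.isDominant hdom) hgh
  have hinj {X Y : Over (Spec (CommRingCat.of k))} {f f' : X ⟶ Y} (hX : X ∈ S₀)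
      (hf : S.GeneratedArr f) (hf' : S.GeneratedArr f')
      (h : j ⟨X, hX⟩ ≫ f.left = j ⟨X, hX⟩ ≫ f'.left) : f = f' := by
    obtain ⟨g, hg, hfg, hgf⟩ := hf'.exists_inverse hconn hgen hepi
    obtain ⟨n, hn, hpow⟩ := (hf.comp _ _ hg).exists_pow_eq_one hgen hepi
    -- the automorphism `f ≫ g` has finite order and fixes the chosen point of `X`
    have h1 : j ⟨X, hX⟩ ≫ (f ≫ g).left = j ⟨X, hX⟩ := by
      rw [Over.comp_left, reassoc_of% h, ← Over.comp_left, hfg, Over.id_left, Category.comp_id]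
    have h2 : f ≫ g = 𝟙 X := hj ⟨X, hX⟩ _ h1 n hn hpow
    rw [← Category.comp_id f, ← hgf, ← Category.assoc, h2, Category.id_comp]
  have hsrc (a : S.generated.arr.toSet) : a.1.left ∈ S₀ := hobj ▸ (S.generated.source_mem a.2)
  have htgt (a : S.generated.arr.toSet) : a.1.right ∈ S₀ := hobj ▸ (S.generated.target_mem a.2)
  let F (a : S.generated.arr.toSet) : T :=
    ⟨(⟨a.1.left, hsrc a⟩, ⟨a.1.right, htgt a⟩), j ⟨a.1.left, hsrc a⟩ ≫ a.1.hom.left⟩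
  have hF : Function.Injective F := by
    rintro ⟨⟨X, Y, f⟩, hf⟩ ⟨⟨X', Y', f'⟩, hf'⟩ h
    obtain ⟨h1, h2⟩ := Sigma.mk.inj_iff.1 h
    obtain rfl : X = X' := congrArg (fun q ↦ q.1.1) h1
    obtain rfl : Y = Y' := congrArg (fun q ↦ q.2.1) h1
    obtain rfl : f = f' := hinj (hsrc ⟨_, hf⟩) hf hf' (eq_of_heq h2)
    rfl
  calc S.generated.order = ENat.card S.generated.arr.toSet := rfl
    _ ≤ ENat.card T := ENat.card_le_card_of_injective hF
    _ = Nat.card T := ENat.card_eq_coe_natCard T
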